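/- Let $N,p,B\ge 1$ be integers, $a\in(0,1)$, and $R,F,G,\epsilon$ reals with $F,G,\epsilon>0$. There is a constant $C$, depending only on $N,p,a,B,R,F,G,\epsilon$, such that the following holds. **Problem.** For each node $i\in\mathcal V=\{1,\dots,N\}$ let $X_i\subset\mathbb R^{d_i}$ be compact and convex with diameter at most $R$, let $g_i:\mathbb R^{d_i}\to\mathbb R^p$ be (component-wise) convex on $X_i$ with $\|g_i(x)\|\le F$ on $X_i$, and let $f_{i,t}:\mathbb R^{d_i}\to\mathbb R$, $t\ge1$, be convex on $X_i$. Let $\partial f_{i,t}(x)$ denote a chosen subgradient of $f_{i,t}$ at $x\in X_i$ (a vector $v$ with $f_{i,t}(z)\ge f_{i,t}(x)+\langle v,z-x\rangle$ for all $z\in X_i$), and assume $\|\partial f_{i,t}(x)\|\le G$ for all $i$, all $t\ge 1$ and all $x\in X_i$. Assume Slater's condition: there are $\hat x_i\in\operatorname{relint}(X_i)$, $i\in\mathcal V$, with $\sum_{i=1}^N g_i(\hat x_i)\le-\epsilon\mathbf 1_p$ component-wise. **Network.** For each $t\ge1$ let $\mathcal G_t=(\mathcal V,\mathcal E_t)$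 be a directed graph, let $\mathcal N^{\rm in}_{i,t}=\{j:(j,i)\in\mathcal E_t\}\cup\{i\}$, and let $W_t=(w_{ij,t})$ be a real matrix with $w_{ij,t}>0$ if $j\in\mathcal N^{\rm in}_{i,t}$ and $w_{ij,t}=0$ otherwise. Assume that $w_{ij,t}>a$ whenever $w_{ij,t}>0$, that each $W_t$ is column stochastic ($\sum_i w_{ij,t}=1$ for all $j$), and that for each integer $k\ge0$ the directed graph $(\mathcal V,\bigcup_{t=kB+1}^{(k+1)B}\mathcal E_t)$ is strongly connected. **Algorithm (DUST with $\alpha_t=\sqrt t$, $\eta_t=t$).** Start from arbitrary $x_{i,1}\in X_i$ with $c_{i,1}=1$, $\mu_{i,1}=\mathbf 0_p$, $y_{i,1}=g_i(x_{i,1})$, and for $t\ge1$ and every $i$ put $$c_{i,t+1}=\sum_{j\in\mathcal N^{\rm in}_{i,t}}w_{ij,t}c_{j,t},\qquad \lambda_{i,t+1}=\frac{1}{c_{i,t+1}}\sum_{j\in\mathcal N^{\rm in}_{i,t}}w_{ij,t}\mu_{j,t},$$ $$x_{i,t+1}\in\operatorname*{arg\,min}_{x\in X_i}\Big\{\alpha_t\langle\partial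 f_{i,t}(x_{i,t}),x-x_{i,t}\rangle+\langle\lambda_{i,t+1},g_i(x)\rangle+\eta_t\|x-x_{i,t}\|^2\Big\},$$ $$y_{i,t+1}=\sum_{j\in\mathcal N^{\rm in}_{i,t}}w_{ij,t}y_{j,t}+g_i(x_{i,t+1})-g_i(x_{i,t}),\qquad \mu_{i,t+1}=\Big[\sum_{j\in\mathcal N^{\rm in}_{i,t}}w_{ij,t}\mu_{j,t}+y_{i,t+1}\Big]_+,$$ where $[\cdot]_+$ is the component-wise projection onto $\mathbb R^p_+$ and $\|\cdot\|$ is the Euclidean norm. **Conclusion.** For every such problem, network and run of the algorithm, and every $T\ge1$, $$\operatorname{Reg}^c(T):=\Big\|\Big[\sum_{t=1}^T\sum_{i=1}^N g_i(x_{i,t})\Big]_+\Big\|\le C\sqrt T .$$ -/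

import Mathlib

open scoped BigOperators

noncomputable section

/-- `ℝⁿ` with the Euclidean norm and the standard inner product. -/
abbrev Vec (n : ℕ) : Type := EuclideanSpace ℝ (Fin n)

/-- The component-wise projection `[v]₊` of `v` onto the nonnegative orthant. -/
def posProj {p : ℕ} (v : Vec p) : Vec p := WithLp.toLp 2 (fun k => max (v k) 0)

/-- `v` is a subgradient at `x` of the function `f`, considered on the set `X`. For `X = univ` this
is the usual subgradient of a function on the whole space; a subgradient on the whole space is a
subgradient on every `X`. -/
def IsSubgradientOn {n : ℕ} (X : Set (Vec n)) (f : Vec n → ℝ) (x v : Vec n) : Prop :=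
  ∀ y ∈ X, f x + inner ℝ v (y - x) ≤ f y

/-- The data of the online problem with `N` nodes and `p` coupled constraints: at time `t`, minimize
`∑ i, f i t (x i)` subject to `∑ i, g i (x i) ≤ 0` and `x i ∈ X i` for every node `i`. -/
structure OnlineProblem (N p : ℕ) where
  /-- dimension of the decision of each node -/
  d : Fin N → ℕ
  /-- local constraint sets -/
  X : ∀ i, Set (Vec (d i))
  /-- local cost functions, depending on the time -/
  f : ∀ i, ℕ → Vec (d i) → ℝ
  /-- local constraint functions -/
  g : ∀ i, Vec (d i) → Vec p

/-- Compactness and convexity of the local constraint sets, with diameters at most `R`, and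
convexity of the local cost and (component-wise) constraint functions on them. -/
structure OnlineProblem.IsConvex {N p : ℕ} (P : OnlineProblem N p) (R : ℝ) : Prop where
  isCompact : ∀ i, IsCompact (P.X i)
  convex : ∀ i, Convex ℝ (P.X i)
  diam_le : ∀ i, Metric.diam (P.X i) ≤ R
  convex_f : ∀ i, ∀ t, 1 ≤ t → ConvexOn ℝ (P.X i) (P.f i t)
  convex_g : ∀ i, ∀ k, ConvexOn ℝ (P.X i) (fun x => P.g i x k)

/-- Slater's condition with constant `ε`. -/
def OnlineProblem.Slater {N p : ℕ} (P : OnlineProblem N p) (ε : ℝ) : Prop :=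
  ∃ xhat : ∀ i, Vec (P.d i), (∀ i, xhat i ∈ intrinsicInterior ℝ (P.X i)) ∧
    ∀ k, (∑ i, P.g i (xhat i)) k ≤ -ε

/-- A choice `s i t x` of a subgradient of `f i t` at each point `x` of `X i`, for `t ≥ 1`. -/
def OnlineProblem.IsSubgradientChoice {N p : ℕ} (P : OnlineProblem N p)
    (s : ∀ i, ℕ → Vec (P.d i) → Vec (P.d i)) : Prop :=
  ∀ i, ∀ t, 1 ≤ t → ∀ x ∈ P.X i, IsSubgradientOn (P.X i) (P.f i t) x (s i t x)

open Classical in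
/-- In-neighbors of `i`, including `i` itself; `E.Adj j i` means that `i` can receive a message
from `j`. -/
def inNeighbors {N : ℕ} (E : Digraph (Fin N)) (i : Fin N) : Finset (Fin N) :=
  Finset.univ.filter (fun j => E.Adj j i ∨ j = i)

/-- The assumptions on the time-varying directed graphs `E t` and on their mixing matrices `W t`,
`t ≥ 1`. -/
structure IsNetwork {N : ℕ} (E : ℕ → Digraph (Fin N)) (W : ℕ → Matrix (Fin N) (Fin N) ℝ)
    (a : ℝ) (B : ℕ) : Prop where
  pos_of_mem : ∀ t, 1 ≤ t → ∀ i, ∀ j ∈ inNeighbors (E t) i, 0 < W t i j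
  zero_of_notMem : ∀ t, 1 ≤ t → ∀ i, ∀ j ∉ inNeighbors (E t) i, W t i j = 0
  nondegenerate : ∀ t, 1 ≤ t → ∀ i j, 0 < W t i j → a < W t i j
  column_stochastic : ∀ t, 1 ≤ t → ∀ j, ∑ i, W t i j = 1
  /-- For each `k`, the union of the graphs at the times `kB + 1, …, (k + 1)B` is strongly connected:
  there is a directed path from every node to every other node. -/
  connected : ∀ k : ℕ, ∀ i j, Relation.ReflTransGen
    (fun u v => ∃ t ∈ Finset.Icc (k * B + 1) ((k + 1) * B), (E t).Adj u v) i j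

/-- The sequences `x`, `c`, `lam`, `y`, `μ` (for times `t ≥ 1`; `lam` for times `t ≥ 2`) are generated
by the algorithm DUST with parameters `α t`, `η t` and subgradients `s i t (x i t)` of `f i t`. -/
structure IsDUST {N p : ℕ} (P : OnlineProblem N p) (E : ℕ → Digraph (Fin N))
    (W : ℕ → Matrix (Fin N) (Fin N) ℝ) (s : ∀ i, ℕ → Vec (P.d i) → Vec (P.d i))
    (α η : ℕ → ℝ) (x : ∀ i, ℕ → Vec (P.d i)) (c : Fin N → ℕ → ℝ)
    (lam y μ : Fin N → ℕ → Vec p) : Prop where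
  x_one : ∀ i, x i 1 ∈ P.X i
  c_one : ∀ i, c i 1 = 1
  μ_one : ∀ i, μ i 1 = 0
  y_one : ∀ i, y i 1 = P.g i (x i 1)
  c_succ : ∀ t, 1 ≤ t → ∀ i, c i (t + 1) = ∑ j ∈ inNeighbors (E t) i, W t i j * c j t
  lam_succ : ∀ t, 1 ≤ t → ∀ i,
    lam i (t + 1) = (c i (t + 1))⁻¹ • ∑ j ∈ inNeighbors (E t) i, W t i j • μ j t
  x_succ_mem : ∀ t, 1 ≤ t → ∀ i, x i (t + 1) ∈ P.X i
  x_succ_isMin : ∀ t, 1 ≤ t → ∀ i, IsMinOn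
    (fun z => α t * inner ℝ (s i t (x i t)) (z - x i t) + inner ℝ (lam i (t + 1)) (P.g i z)
      + η t * ‖z - x i t‖ ^ 2) (P.X i) (x i (t + 1))
  y_succ : ∀ t, 1 ≤ t → ∀ i,
    y i (t + 1) = ∑ j ∈ inNeighbors (E t) i, W t i j • y j t + P.g i (x i (t + 1)) - P.g i (x i t)
  μ_succ : ∀ t, 1 ≤ t → ∀ i,
    μ i (t + 1) = posProj (∑ j ∈ inNeighbors (E t) i, W t i j • μ j t + y i (t + 1))

/-- The cumulative constraint violation up to time `T` of the decisions `x`. -/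
def OnlineProblem.constraintViolation {N p : ℕ} (P : OnlineProblem N p)
    (x : ∀ i, ℕ → Vec (P.d i)) (T : ℕ) : ℝ :=
  ‖posProj (∑ t ∈ Finset.Icc 1 T, ∑ i, P.g i (x i t))‖

end

/-!
The argument is a Lyapunov drift analysis of the total multiplier `m t = ∑ i, μ i t`. The matrices
being column stochastic, `∑ i, y i t = ∑ i, g i (x i t)`, and clipping at `0` only increases, so
`m (t + 1) ≥ m t + ∑ i, g i (x i (t + 1))`: up to the constraint values of time `1`, the accumulated
constraint values are at most `m T`, and it suffices that `m T = O(√T)`.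

*Consensus.* By strong connectivity over windows of length `B`, information from every node reaches
every node within `N * B` steps (`reachSet_eq_univ`). Hence the push-sum weights `c i t` are bounded
below (`IsPushSumWeight.pow_le`). For a column-stochastic recursion `v (t + 1) = W t * v t + e t`, the
quotients `v i t / c i t` obey a row-stochastic recursion, whose spread contracts geometrically, so
bounded perturbations `e` give a bounded spread (`pushSum_spread_bounded`). Applied to `y`, this
shows that `y` is bounded (`tracking_bounded`). Then the increments of `μ` caused by `y` are bounded
too, and applied to `μ` it shows that `lam i (t + 1)` differs from `m t / N` by at most a constant.
Clipping is only active in a component where `m t` is bounded, whence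
`m (t + 1) ^ 2 ≤ m t ^ 2 + 2 * m t * ∑ i, g i (x i (t + 1)) + O(1)` in every component
(`dual_recursion`).

*Drift.* The proximal step is compared with the Slater point `xhat` (`inner_multiplier_le`). With
`D t = ∑ i, ‖xhat i - x i t‖ ^ 2`, this gives
`⟪m t, ∑ i, g i (x i (t + 1))⟫ ≤ -ε * ‖m t‖₁ + O(√t) + N * t * (D t - D (t + 1))` (see `drift_step`).
So the potential `V t = ‖m t‖ ^ 2 + 2 * N * t * D t` satisfies
`V (t + 1) ≤ V t - 2 * ε * ‖m t‖₁ + O(√t)`. Since `D` is bounded, `‖m t‖₁` exceeds any multiple of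
`√t` once `V t` exceeds a suitable multiple of `t`, and then `V` does not increase. Therefore
`V t = O(t)` (`potential_le`), that is, `m t = O(√t)`.
-/

/-! ### Reachability in the time-varying graph -/

/-- The nodes that information held by `j` at time `t₀` has reached at time `t₀ + s`. -/
def reachSet {N : ℕ} (E : ℕ → Digraph (Fin N)) (t₀ : ℕ) (j : Fin N) : ℕ → Set (Fin N)
  | 0 => {j}
  | s + 1 => {i | ∃ l ∈ reachSet E t₀ j s, l ∈ inNeighbors (E (t₀ + s)) i}

theorem self_mem_inNeighbors {N : ℕ} (E : Digraph (Fin N)) (i : Fin N) : i ∈ inNeighbors E i := by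
  simp [inNeighbors]

theorem reachSet_mono {N : ℕ} (E : ℕ → Digraph (Fin N)) (t₀ : ℕ) (j : Fin N) :
    Monotone (reachSet E t₀ j) :=
  monotone_nat_of_le_succ fun _ i hi => ⟨i, hi, self_mem_inNeighbors _ i⟩

theorem reachSet_eq_univ {N : ℕ} {E : ℕ → Digraph (Fin N)} {W : ℕ → Matrix (Fin N) (Fin N) ℝ}
    {a : ℝ} {B : ℕ} (hnet : IsNetwork E W a B) (k : ℕ) (j : Fin N) {s : ℕ} (hs : N * B ≤ s) :
    reachSet E (k * B + 1) j s = Set.univ := by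
  have key : ∀ m : ℕ, reachSet E (k * B + 1) j (m * B) = Set.univ ∨
      m + 1 ≤ (reachSet E (k * B + 1) j (m * B)).ncard := by
    intro m
    induction m with
    | zero => right; simp [reachSet]
    | succ m ih =>
      have hsub : reachSet E (k * B + 1) j (m * B) ⊆ reachSet E (k * B + 1) j ((m + 1) * B) :=
        reachSet_mono E _ j (Nat.mul_le_mul_right _ (Nat.le_succ m))
      rcases ih with h | h
      · left
        rw [h] at hsub
        exact Set.univ_subset_iff.1 hsub
      by_cases heq : reachSet E (k * B + 1) j (m * B) = reachSet E (k * B + 1) j ((m + 1) * B)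
      · -- a set that does not grow during a window is closed under all edges of that window
        left
        refine Set.eq_univ_of_forall fun i => ?_
        have hj : j ∈ reachSet E (k * B + 1) j ((m + 1) * B) :=
          reachSet_mono E _ j (Nat.zero_le _) (by simp [reachSet])
        refine Relation.ReflTransGen.head_induction_on
          (motive := fun u _ => u ∈ reachSet E (k * B + 1) j ((m + 1) * B) →
            i ∈ reachSet E (k * B + 1) j ((m + 1) * B))
          (hnet.connected (k + m) j i) (fun h => h) ?_ hj
        rintro u v ⟨t, ht, hadj⟩ - ih hu
        apply ih
        rw [Finset.mem_Icc] at ht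
        obtain ⟨r, rfl⟩ : ∃ r, t = k * B + 1 + (m * B + r) :=
          ⟨t - ((k + m) * B + 1), by have := ht.1; rw [add_mul] at this ⊢; omega⟩
        have hr : m * B + r + 1 ≤ (m + 1) * B := by
          have := ht.2
          simp only [add_mul, one_mul] at this ⊢
          omega
        refine reachSet_mono E _ j hr ⟨u, ?_, by simp [inNeighbors, hadj]⟩
        rw [← heq] at hu
        exact reachSet_mono E _ j (Nat.le_add_right _ _) hu
      · right
        have := Set.ncard_lt_ncard (hsub.ssubset_of_ne heq) (Set.toFinite _)
        omega
  have hN : reachSet E (k * B + 1) j (N * B) = Set.univ := by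
    rcases key N with h | h
    · exact h
    · have h2 := Set.ncard_le_ncard (Set.subset_univ (reachSet E (k * B + 1) j (N * B)))
      rw [Set.ncard_univ, Nat.card_fin] at h2
      omega
  have := reachSet_mono E (k * B + 1) j hs
  rw [hN] at this
  exact Set.univ_subset_iff.1 this

/-! ### Perturbed averaging over row-stochastic matrices -/

/-- A node that is below the maximum by `D` at time `t₀` pulls every node it has reached after `s`
steps below the (drifting) maximum by `δ ^ s * D`. -/
theorem averaging_le {N : ℕ} {E : ℕ → Digraph (Fin N)} {A : ℕ → Fin N → Fin N → ℝ} {δ e : ℝ}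
    (hδ : 0 ≤ δ) (hA0 : ∀ t, 1 ≤ t → ∀ i j, 0 ≤ A t i j) (hA1 : ∀ t, 1 ≤ t → ∀ i, ∑ j, A t i j = 1)
    (hAδ : ∀ t, 1 ≤ t → ∀ i, ∀ j ∈ inNeighbors (E t) i, δ ≤ A t i j)
    {u : Fin N → ℕ → ℝ} (hu : ∀ t, 1 ≤ t → ∀ i, u i (t + 1) ≤ ∑ j, A t i j * u j t + e)
    {t₀ : ℕ} (ht₀ : 1 ≤ t₀) {M D : ℝ} (hD : 0 ≤ D) (hM : ∀ i, u i t₀ ≤ M) {j : Fin N}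
    (hj : u j t₀ ≤ M - D) (s : ℕ) :
    (∀ i, u i (t₀ + s) ≤ M + s * e) ∧
      ∀ i ∈ reachSet E t₀ j s, u i (t₀ + s) ≤ M + s * e - δ ^ s * D := by
  induction s with
  | zero =>
    refine ⟨by simpa using hM, ?_⟩
    intro i hi
    obtain rfl : i = j := by simpa [reachSet] using hi
    simpa using hj
  | succ s ih =>
    obtain ⟨ih1, ih2⟩ := ih
    have ht : 1 ≤ t₀ + s := by omega
    have hsum : ∀ i, ∑ l, A (t₀ + s) i l * (M + s * e) = M + s * e := fun i => by
      rw [← Finset.sum_mul, hA1 _ ht i, one_mul]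
    refine ⟨fun i => ?_, fun i hi => ?_⟩
    · have h1 := hu (t₀ + s) ht i
      have h2 : ∑ l, A (t₀ + s) i l * u l (t₀ + s) ≤ ∑ l, A (t₀ + s) i l * (M + s * e) :=
        Finset.sum_le_sum fun l _ => mul_le_mul_of_nonneg_left (ih1 l) (hA0 _ ht i l)
      rw [hsum] at h2
      rw [← add_assoc]
      push_cast
      linarith
    · obtain ⟨l, hl, hli⟩ := hi
      have h1 := hu (t₀ + s) ht i
      have h3 : A (t₀ + s) i l * (M + s * e - u l (t₀ + s)) ≤
          ∑ l, A (t₀ + s) i l * (M + s * e - u l (t₀ + s)) :=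
        Finset.single_le_sum (f := fun l => A (t₀ + s) i l * (M + s * e - u l (t₀ + s)))
          (fun l _ => mul_nonneg (hA0 _ ht i l) (sub_nonneg.2 (ih1 l))) (Finset.mem_univ l)
      simp only [mul_sub] at h3
      rw [Finset.sum_sub_distrib] at h3
      have h4 : δ * (δ ^ s * D) ≤ A (t₀ + s) i l * (M + s * e - u l (t₀ + s)) :=
        mul_le_mul (hAδ _ ht i l hli) (by linarith [ih2 l hl]) (by positivity) (hA0 _ ht i l)
      have h5 := hsum i
      simp only [mul_add, mul_sub] at h3 h4 h5
      rw [← add_assoc, pow_succ]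
      push_cast
      linarith

/-- Over `N` windows of connectivity, the spread of the values contracts by a fixed factor, up to the
accumulated perturbations. -/
theorem averaging_contraction {N : ℕ} {E : ℕ → Digraph (Fin N)}
    {W : ℕ → Matrix (Fin N) (Fin N) ℝ} {a : ℝ} {B : ℕ} (hnet : IsNetwork E W a B)
    {A : ℕ → Fin N → Fin N → ℝ} {δ e : ℝ} (hδ : 0 ≤ δ) (hδ1 : δ ≤ 1)
    (hA0 : ∀ t, 1 ≤ t → ∀ i j, 0 ≤ A t i j) (hA1 : ∀ t, 1 ≤ t → ∀ i, ∑ j, A t i j = 1)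
    (hAδ : ∀ t, 1 ≤ t → ∀ i, ∀ j ∈ inNeighbors (E t) i, δ ≤ A t i j)
    {u : Fin N → ℕ → ℝ} (hu : ∀ t, 1 ≤ t → ∀ i, |u i (t + 1) - ∑ j, A t i j * u j t| ≤ e)
    {t₀ : ℕ} (ht₀ : 1 ≤ t₀) {D : ℝ} (hD : ∀ i j, u i t₀ - u j t₀ ≤ D) :
    (∀ s : ℕ, ∀ i j, u i (t₀ + s) - u j (t₀ + s) ≤ D + 2 * s * e) ∧
      ∀ k : ℕ, t₀ = k * B + 1 → ∀ i j, u i (t₀ + N * B) - u j (t₀ + N * B) ≤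
        (1 - δ ^ (N * B)) * D + 2 * (N * B : ℕ) * e := by
  rcases Nat.eq_zero_or_pos N with rfl | hN
  · exact ⟨fun _ i => i.elim0, fun _ _ i => i.elim0⟩
  have : Nonempty (Fin N) := ⟨⟨0, hN⟩⟩
  obtain ⟨iM, hiM⟩ := Finite.exists_max fun i => u i t₀
  obtain ⟨im, him⟩ := Finite.exists_min fun i => u i t₀
  have hup := averaging_le (u := u) (e := e) hδ hA0 hA1 hAδ
    (fun t ht i => by linarith [(abs_le.1 (hu t ht i)).2]) ht₀ (D := u iM t₀ - u im t₀)
    (sub_nonneg.2 (hiM im)) hiM (j := im) (by linarith)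
  have hlo := averaging_le (u := fun i t => -u i t) (e := e) hδ hA0 hA1 hAδ
    (fun t ht i => by
      simp only [mul_neg, Finset.sum_neg_distrib]
      linarith [(abs_le.1 (hu t ht i)).1]) ht₀ (D := 0) le_rfl (M := -u im t₀)
    (fun i => neg_le_neg (him i)) (j := im) (by simp)
  have hDm := hD iM im
  refine ⟨fun s i j => ?_, fun k hk i j => ?_⟩
  · linarith [(hup s).1 i, (hlo s).1 j]
  · have h1 := (hup (N * B)).2 i (by rw [hk, reachSet_eq_univ hnet k im le_rfl]; trivial)
    have h2 := (hlo (N * B)).1 j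
    have h3 : δ ^ (N * B) ≤ 1 := pow_le_one₀ hδ hδ1
    nlinarith

theorem averaging_bounded {N : ℕ} {E : ℕ → Digraph (Fin N)}
    {W : ℕ → Matrix (Fin N) (Fin N) ℝ} {a : ℝ} {B : ℕ} (hnet : IsNetwork E W a B) (hB : 0 < B)
    {A : ℕ → Fin N → Fin N → ℝ} {δ e : ℝ} (hδ : 0 < δ) (hδ1 : δ ≤ 1) (he : 0 ≤ e)
    (hA0 : ∀ t, 1 ≤ t → ∀ i j, 0 ≤ A t i j) (hA1 : ∀ t, 1 ≤ t → ∀ i, ∑ j, A t i j = 1)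
    (hAδ : ∀ t, 1 ≤ t → ∀ i, ∀ j ∈ inNeighbors (E t) i, δ ≤ A t i j)
    {u : Fin N → ℕ → ℝ} (hu : ∀ t, 1 ≤ t → ∀ i, |u i (t + 1) - ∑ j, A t i j * u j t| ≤ e)
    {D : ℝ} (hD0 : 0 ≤ D) (hD : ∀ i j, u i 1 - u j 1 ≤ D) (t : ℕ) (ht : 1 ≤ t) (i j : Fin N) :
    u i t - u j t ≤ D + 2 * (N * B : ℕ) * e / δ ^ (N * B) + 2 * (N * B : ℕ) * e := by
  have hN : 0 < N := i.pos
  set L := N * B with hL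
  have hLpos : 0 < L := Nat.mul_pos hN hB
  have hq : 0 < δ ^ L := pow_pos hδ L
  set K := D + 2 * (L : ℝ) * e / δ ^ L with hK
  have hKq : 2 * (L : ℝ) * e ≤ δ ^ L * K := by
    rw [hK, mul_add, mul_div_cancel₀ _ hq.ne']
    have := mul_nonneg hq.le hD0
    linarith
  -- `K` is preserved by `D ↦ (1 - δ ^ L) * D + 2 * L * e`
  have hwin : ∀ q : ℕ, ∀ i j, u i (q * L + 1) - u j (q * L + 1) ≤ K := by
    intro q
    induction q with
    | zero =>
      intro i j
      have h0 : 0 ≤ 2 * (L : ℝ) * e / δ ^ L := by positivity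
      simpa using (hD i j).trans (by linarith)
    | succ q ih =>
      intro i j
      have := (averaging_contraction hnet hδ.le hδ1 hA0 hA1 hAδ hu (by omega) ih).2 (q * N)
        (by rw [hL, mul_assoc]) i j
      rw [← hL, show q * L + 1 + L = (q + 1) * L + 1 by ring] at this
      linarith
  have h1 := (averaging_contraction hnet hδ.le hδ1 hA0 hA1 hAδ hu (by omega)
    (hwin ((t - 1) / L))).1 ((t - 1) % L) i j
  have h2 : (t - 1) / L * L + 1 + (t - 1) % L = t := by
    have := Nat.div_add_mod' (t - 1) L
    omega
  rw [h2] at h1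
  have h3 : (((t - 1) % L : ℕ) : ℝ) ≤ L := by exact_mod_cast (Nat.mod_lt _ hLpos).le
  nlinarith [mul_le_mul_of_nonneg_right h3 he]

/-! ### Push-sum over column-stochastic matrices -/

theorem IsNetwork.nonneg {N : ℕ} {E : ℕ → Digraph (Fin N)} {W : ℕ → Matrix (Fin N) (Fin N) ℝ}
    {a : ℝ} {B : ℕ} (hnet : IsNetwork E W a B) {t : ℕ} (ht : 1 ≤ t) (i j : Fin N) :
    0 ≤ W t i j := by
  by_cases h : j ∈ inNeighbors (E t) i
  · exact (hnet.pos_of_mem t ht i j h).le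
  · exact (hnet.zero_of_notMem t ht i j h).ge

theorem IsNetwork.sum_inNeighbors {N : ℕ} {E : ℕ → Digraph (Fin N)}
    {W : ℕ → Matrix (Fin N) (Fin N) ℝ} {a : ℝ} {B : ℕ} (hnet : IsNetwork E W a B) {V : Type*}
    [AddCommGroup V] [Module ℝ V] {t : ℕ} (ht : 1 ≤ t) (i : Fin N) (v : Fin N → V) :
    ∑ j ∈ inNeighbors (E t) i, W t i j • v j = ∑ j, W t i j • v j :=
  Finset.sum_subset (Finset.subset_univ _) fun j _ hj => by
    rw [hnet.zero_of_notMem t ht i j hj, zero_smul]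

theorem IsNetwork.sum_sum_mul {N : ℕ} {E : ℕ → Digraph (Fin N)}
    {W : ℕ → Matrix (Fin N) (Fin N) ℝ} {a : ℝ} {B : ℕ} (hnet : IsNetwork E W a B)
    {t : ℕ} (ht : 1 ≤ t) (v : Fin N → ℝ) :
    ∑ i, ∑ j, W t i j * v j = ∑ j, v j := by
  rw [Finset.sum_comm]
  exact Finset.sum_congr rfl fun j _ => by
    rw [← Finset.sum_mul, hnet.column_stochastic t ht j, one_mul]

/-- The push-sum weights: the image of the all-ones vector under the mixing matrices. -/
def IsPushSumWeight {N : ℕ} (W : ℕ → Matrix (Fin N) (Fin N) ℝ) (c : Fin N → ℕ → ℝ) : Prop :=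
  (∀ i, c i 1 = 1) ∧ ∀ t, 1 ≤ t → ∀ i, c i (t + 1) = ∑ j, W t i j * c j t

theorem IsPushSumWeight.nonneg {N : ℕ} {E : ℕ → Digraph (Fin N)}
    {W : ℕ → Matrix (Fin N) (Fin N) ℝ} {a : ℝ} {B : ℕ} (hnet : IsNetwork E W a B)
    {c : Fin N → ℕ → ℝ} (hc : IsPushSumWeight W c) {t : ℕ} (ht : 1 ≤ t) :
    ∀ i, 0 ≤ c i t := by
  induction t, ht using Nat.le_induction with
  | base => intro i; rw [hc.1]; exact zero_le_one
  | succ t ht ih =>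
    intro i
    rw [hc.2 t ht]
    exact Finset.sum_nonneg fun j _ => mul_nonneg (hnet.nonneg ht i j) (ih j)

theorem IsPushSumWeight.sum_eq {N : ℕ} {E : ℕ → Digraph (Fin N)}
    {W : ℕ → Matrix (Fin N) (Fin N) ℝ} {a : ℝ} {B : ℕ} (hnet : IsNetwork E W a B)
    {c : Fin N → ℕ → ℝ} (hc : IsPushSumWeight W c) {t : ℕ} (ht : 1 ≤ t) :
    ∑ i, c i t = N := by
  induction t, ht using Nat.le_induction with
  | base => simp [hc.1]
  | succ t ht ih => simp only [hc.2 t ht, hnet.sum_sum_mul ht, ih]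

theorem IsPushSumWeight.le_card {N : ℕ} {E : ℕ → Digraph (Fin N)}
    {W : ℕ → Matrix (Fin N) (Fin N) ℝ} {a : ℝ} {B : ℕ} (hnet : IsNetwork E W a B)
    {c : Fin N → ℕ → ℝ} (hc : IsPushSumWeight W c) {t : ℕ} (ht : 1 ≤ t) (i : Fin N) :
    c i t ≤ N := by
  rw [← hc.sum_eq hnet ht]
  exact Finset.single_le_sum (f := fun i => c i t) (fun j _ => hc.nonneg hnet ht j)
    (Finset.mem_univ i)

theorem IsPushSumWeight.pow_le_of_mem_reachSet {N : ℕ} {E : ℕ → Digraph (Fin N)}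
    {W : ℕ → Matrix (Fin N) (Fin N) ℝ} {a : ℝ} {B : ℕ} (ha : 0 < a) (hnet : IsNetwork E W a B)
    {c : Fin N → ℕ → ℝ} (hc : IsPushSumWeight W c) {t₀ : ℕ} (ht₀ : 1 ≤ t₀) {j : Fin N}
    (hj : 1 ≤ c j t₀) (s : ℕ) : ∀ i ∈ reachSet E t₀ j s, a ^ s ≤ c i (t₀ + s) := by
  induction s with
  | zero =>
    intro i hi
    obtain rfl : i = j := by simpa [reachSet] using hi
    simpa using hj
  | succ s ih =>
    rintro i ⟨l, hl, hli⟩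
    have ht : 1 ≤ t₀ + s := by omega
    have hW := hnet.nondegenerate _ ht i l (hnet.pos_of_mem _ ht i l hli)
    rw [← add_assoc, hc.2 _ ht, pow_succ']
    calc a * a ^ s ≤ W (t₀ + s) i l * c l (t₀ + s) :=
          mul_le_mul hW.le (ih l hl) (by positivity) (hnet.nonneg ht i l)
      _ ≤ _ := Finset.single_le_sum (f := fun l => W (t₀ + s) i l * c l (t₀ + s))
          (fun l _ => mul_nonneg (hnet.nonneg ht i l) (hc.nonneg hnet ht l)) (Finset.mem_univ l)

theorem IsPushSumWeight.pow_le {N : ℕ} {E : ℕ → Digraph (Fin N)}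
    {W : ℕ → Matrix (Fin N) (Fin N) ℝ} {a : ℝ} {B : ℕ} (ha : 0 < a) (ha1 : a < 1) (hB : 0 < B)
    (hnet : IsNetwork E W a B) {c : Fin N → ℕ → ℝ} (hc : IsPushSumWeight W c) {t : ℕ}
    (ht : 1 ≤ t) (i : Fin N) : a ^ (N * B + B) ≤ c i t := by
  have hmod := Nat.div_add_mod' (t - 1) B
  have hlt := Nat.mod_lt (t - 1) hB
  rcases lt_or_ge (t - 1) (N * B) with h | h
  · have h1 := hc.pow_le_of_mem_reachSet ha hnet le_rfl (hc.1 i).ge (t - 1) i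
      (reachSet_mono E 1 i (Nat.zero_le _) (by simp [reachSet]))
    rw [show 1 + (t - 1) = t by omega] at h1
    exact (pow_le_pow_of_le_one ha.le ha1.le (by omega)).trans h1
  · -- go back `N` full windows, to a time when some weight is at least the average weight `1`
    have hk : N ≤ (t - 1) / B := (Nat.le_div_iff_mul_le hB).2 h
    obtain ⟨k, hk⟩ := Nat.exists_eq_add_of_le' hk
    rw [hk, add_mul] at hmod
    have ht₀ : 1 ≤ k * B + 1 := by omega
    obtain ⟨j, -, hj⟩ : ∃ j ∈ (Finset.univ : Finset (Fin N)), (1 : ℝ) ≤ c j (k * B + 1) := by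
      refine Finset.exists_le_of_sum_le ⟨i, Finset.mem_univ i⟩ ?_
      rw [hc.sum_eq hnet ht₀]
      simp
    have h1 := hc.pow_le_of_mem_reachSet ha hnet ht₀ hj (N * B + (t - 1) % B) i
      (by rw [reachSet_eq_univ hnet k j (Nat.le_add_right _ _)]; trivial)
    rw [show k * B + 1 + (N * B + (t - 1) % B) = t by omega] at h1
    exact (pow_le_pow_of_le_one ha.le ha1.le (by omega)).trans h1

/-- Dividing by the push-sum weights turns column-stochastic mixing into averaging with the
row-stochastic matrices `(c i (t + 1))⁻¹ * W t i j * c j t`, so the spread of the quotients stays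
bounded under bounded perturbations. -/
theorem pushSum_spread_bounded (N B : ℕ) (a D e : ℝ) (ha : 0 < a) (ha1 : a < 1) (hB : 0 < B)
    (hD : 0 ≤ D) (he : 0 ≤ e) :
    ∃ Q : ℝ, 0 ≤ Q ∧ ∀ (E : ℕ → Digraph (Fin N)) (W : ℕ → Matrix (Fin N) (Fin N) ℝ)
      (c v : Fin N → ℕ → ℝ), IsNetwork E W a B → IsPushSumWeight W c →
      (∀ i j, v i 1 - v j 1 ≤ D) →
      (∀ t, 1 ≤ t → ∀ i, |v i (t + 1) - ∑ j, W t i j * v j t| ≤ e) →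
      ∀ t, 1 ≤ t → ∀ i j, v i t / c i t - v j t / c j t ≤ Q := by
  rcases Nat.eq_zero_or_pos N with rfl | hN
  · exact ⟨0, le_rfl, fun _ _ _ _ _ _ _ _ _ _ i => i.elim0⟩
  have hN' : (1 : ℝ) ≤ N := by exact_mod_cast hN
  set κ := a ^ (N * B + B) with hκ
  have hκ0 : 0 < κ := pow_pos ha _
  have hκ1 : κ ≤ 1 := pow_le_one₀ ha.le ha1.le
  set δ := a * κ / N with hδ
  have hδ0 : 0 < δ := by positivity
  have hδ1 : δ ≤ 1 := by
    rw [hδ, div_le_one (by linarith)]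
    nlinarith
  refine ⟨D + 2 * (N * B : ℕ) * (e / κ) / δ ^ (N * B) + 2 * (N * B : ℕ) * (e / κ), by positivity,
    fun E W c v hnet hc hv1 hv t ht i j => ?_⟩
  have hcκ : ∀ {t}, 1 ≤ t → ∀ i, κ ≤ c i t := fun ht i => hc.pow_le ha ha1 hB hnet ht i
  have hcpos : ∀ {t}, 1 ≤ t → ∀ i, 0 < c i t := fun ht i => hκ0.trans_le (hcκ ht i)
  refine averaging_bounded (A := fun t i j => W t i j * c j t / c i (t + 1))
    (u := fun i t => v i t / c i t) hnet hB hδ0 hδ1 (by positivity) ?_ ?_ ?_ ?_ hD ?_ t ht i j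
  · intro t ht i j
    exact div_nonneg (mul_nonneg (hnet.nonneg ht i j) (hcpos ht j).le) (hcpos (by omega) i).le
  · intro t ht i
    rw [← Finset.sum_div, ← hc.2 t ht i, div_self (hcpos (by omega) i).ne']
  · intro t ht i j hij
    have hW := hnet.nondegenerate t ht i j (hnet.pos_of_mem t ht i j hij)
    have h1 : a * κ ≤ W t i j * c j t :=
      mul_le_mul hW.le (hcκ ht j) hκ0.le (hnet.nonneg ht i j)
    exact div_le_div₀ ((by positivity : (0 : ℝ) ≤ a * κ).trans h1) h1 (hcpos (by omega) i)
      (hc.le_card hnet (by omega) i)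
  · intro t ht i
    have hci := hcpos (show 1 ≤ t + 1 by omega) i
    have h1 : ∑ j, W t i j * c j t / c i (t + 1) * (v j t / c j t) =
        (∑ j, W t i j * v j t) / c i (t + 1) := by
      rw [Finset.sum_div]
      refine Finset.sum_congr rfl fun j _ => ?_
      have := (hcpos ht j).ne'
      field_simp
    rw [h1, ← sub_div, abs_div, abs_of_pos hci]
    exact div_le_div₀ he (hv t ht i) hκ0 (hcκ (by omega) i)
  · intro i j
    simpa [hc.1] using hv1 i j

theorem abs_weighted_average_sub_le {ι : Type*} (I : Finset ι) {w b : ι → ℝ} {S r Q : ℝ}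
    (hw : ∀ j ∈ I, 0 ≤ w j) (hS : ∑ j ∈ I, w j = S) (hS0 : 0 < S)
    (hb : ∀ j ∈ I, |b j - r| ≤ Q) : |(∑ j ∈ I, w j * b j) / S - r| ≤ Q := by
  have h1 : (∑ j ∈ I, w j * b j) / S - r = (∑ j ∈ I, w j * (b j - r)) / S := by
    simp only [mul_sub, Finset.sum_sub_distrib, ← Finset.sum_mul, hS]
    field_simp
  rw [h1, abs_div, abs_of_pos hS0, div_le_iff₀ hS0]
  calc |∑ j ∈ I, w j * (b j - r)| ≤ ∑ j ∈ I, |w j * (b j - r)| := Finset.abs_sum_le_sum_abs _ _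
    _ ≤ ∑ j ∈ I, w j * Q := Finset.sum_le_sum fun j hj => by
        rw [abs_mul, abs_of_nonneg (hw j hj)]
        exact mul_le_mul_of_nonneg_left (hb j hj) (hw j hj)
    _ = Q * S := by rw [← Finset.sum_mul, hS, mul_comm]

/-! ### Tracking of the constraint values and consensus of the multipliers -/

/-- The trackers `y` of the bounded signals `g` stay bounded: their quotients by the push-sum weights
have bounded spread, and the weighted mean of these quotients is the mean of the `g i t`. -/
theorem tracking_bounded (N B : ℕ) (a F : ℝ) (ha : 0 < a) (ha1 : a < 1) (hB : 0 < B)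
    (hF : 0 ≤ F) :
    ∃ Y : ℝ, 0 ≤ Y ∧ ∀ (E : ℕ → Digraph (Fin N)) (W : ℕ → Matrix (Fin N) (Fin N) ℝ)
      (c y g : Fin N → ℕ → ℝ), IsNetwork E W a B → IsPushSumWeight W c →
      (∀ t, 1 ≤ t → ∀ i, |g i t| ≤ F) → (∀ i, y i 1 = g i 1) →
      (∀ t, 1 ≤ t → ∀ i, y i (t + 1) = ∑ j, W t i j * y j t + g i (t + 1) - g i t) →
      ∀ t, 1 ≤ t → ∑ i, y i t = ∑ i, g i t ∧ ∀ i, |y i t| ≤ Y := by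
  obtain ⟨Q, hQ0, hQ⟩ := pushSum_spread_bounded N B a (2 * F) (2 * F) ha ha1 hB (by linarith)
    (by linarith)
  refine ⟨N * (Q + F), by positivity, fun E W c y g hnet hc hg hy1 hy t ht => ?_⟩
  have hsum : ∑ i, y i t = ∑ i, g i t := by
    induction t, ht using Nat.le_induction with
    | base => simp only [hy1]
    | succ t ht ih =>
      simp only [hy t ht, Finset.sum_sub_distrib, Finset.sum_add_distrib, hnet.sum_sum_mul ht, ih]
      ring
  refine ⟨hsum, fun i => ?_⟩
  have hN : 0 < (N : ℝ) := by exact_mod_cast i.pos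
  have hcpos : ∀ i, 0 < c i t := fun i => (pow_pos ha _).trans_le (hc.pow_le ha ha1 hB hnet ht i)
  have hosc := hQ E W c y hnet hc
    (fun i j => by
      rw [hy1, hy1]
      linarith [(abs_le.1 (hg 1 le_rfl i)).2, (abs_le.1 (hg 1 le_rfl j)).1])
    (fun t ht i => by
      rw [hy t ht i, abs_le]
      constructor <;> linarith [(abs_le.1 (hg t ht i)).1, (abs_le.1 (hg t ht i)).2,
        (abs_le.1 (hg (t + 1) (by omega) i)).1, (abs_le.1 (hg (t + 1) (by omega) i)).2]) t ht
  have h1 := abs_weighted_average_sub_le Finset.univ (w := fun j => c j t)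
    (b := fun j => y j t / c j t) (r := y i t / c i t) (Q := Q) (fun j _ => (hcpos j).le)
    (hc.sum_eq hnet ht) hN
    (fun j _ => abs_le.2 ⟨by linarith [hosc i j], hosc j i⟩)
  simp only [fun j => mul_div_cancel₀ (y j t) (hcpos j).ne', hsum] at h1
  have h2 : |(∑ j, g j t) / N| ≤ F := by
    rw [abs_div, abs_of_pos hN, div_le_iff₀ hN]
    calc |∑ j, g j t| ≤ ∑ j, |g j t| := Finset.abs_sum_le_sum_abs _ _
      _ ≤ ∑ _j : Fin N, F := Finset.sum_le_sum fun j _ => hg t ht j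
      _ = F * N := by simp [mul_comm]
  have h3 : |y i t / c i t| ≤ Q + F := by
    rw [abs_le] at h1 h2 ⊢
    constructor <;> linarith [h1.1, h1.2, h2.1, h2.2]
  rw [abs_div, abs_of_pos (hcpos i), div_le_iff₀ (hcpos i)] at h3
  nlinarith [hc.le_card hnet ht i]

/-- The square of the sum of clipped multipliers. The clipping of `v i + y i` at `0` is only active
if `v i ≤ Y`, and then the sum of all `v j` is at most `M`, so that clipping contributes a bounded
amount. -/
theorem sq_sum_clip_le {N : ℕ} {v y : Fin N → ℝ} {Y M : ℝ} (hY : 0 ≤ Y) (hM : 0 ≤ M)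
    (hv : ∀ i, 0 ≤ v i) (hy : ∀ i, |y i| ≤ Y) (hvM : ∀ i, v i ≤ Y → ∑ j, v j ≤ M) :
    (∑ i, max (v i + y i) 0) ^ 2 ≤
      (∑ i, v i) ^ 2 + 2 * (∑ i, v i) * ∑ i, y i + (2 * N * (M * Y) + (N * Y) ^ 2) := by
  set m := ∑ i, v i with hm
  have hm0 : 0 ≤ m := Finset.sum_nonneg fun i _ => hv i
  have hr : ∀ i, m * (max (v i + y i) 0 - v i - y i) ≤ M * Y := by
    intro i
    have hyi := abs_le.1 (hy i)
    rcases le_total 0 (v i + y i) with h | h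
    · rw [max_eq_left h]
      have := mul_nonneg hM hY
      linarith
    · rw [max_eq_right h]
      exact mul_le_mul (hvM i (by linarith)) (by linarith [hv i]) (by linarith) hM
  have hd : ∀ i, |max (v i + y i) 0 - v i| ≤ Y := by
    intro i
    have hyi := abs_le.1 (hy i)
    rcases le_total 0 (v i + y i) with h | h
    · rw [max_eq_left h, add_sub_cancel_left]
      exact hy i
    · rw [max_eq_right h, abs_le]
      constructor <;> linarith [hv i]
  set d := ∑ i, (max (v i + y i) 0 - v i) with hdd
  have h1 : ∑ i, max (v i + y i) 0 = m + d := by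
    rw [hdd, Finset.sum_sub_distrib]
    ring
  have h2 : m * (d - ∑ i, y i) ≤ N * (M * Y) := by
    rw [hdd, ← Finset.sum_sub_distrib, Finset.mul_sum]
    calc _ ≤ ∑ _i : Fin N, M * Y := Finset.sum_le_sum fun i _ => hr i
      _ = _ := by simp
  have h3 : |d| ≤ N * Y := by
    calc |d| ≤ ∑ i, |max (v i + y i) 0 - v i| := Finset.abs_sum_le_sum_abs _ _
      _ ≤ ∑ _i : Fin N, Y := Finset.sum_le_sum fun i _ => hd i
      _ = _ := by simp
  have h4 : d ^ 2 ≤ (N * Y) ^ 2 := sq_le_sq' (abs_le.1 h3).1 (abs_le.1 h3).2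
  rw [h1]
  nlinarith

/-- One component of the dual recursion of DUST: the local multipliers `μ`, before the minimization
step, agree with the mean multiplier up to a constant, and the sum of the multipliers satisfies the
drift inequality of a projected dual ascent, again up to a constant. -/
theorem dual_recursion (N B : ℕ) (a F : ℝ) (ha : 0 < a) (ha1 : a < 1) (hB : 0 < B)
    (hF : 0 ≤ F) :
    ∃ Q K : ℝ, 0 ≤ Q ∧ 0 ≤ K ∧ ∀ (E : ℕ → Digraph (Fin N)) (W : ℕ → Matrix (Fin N) (Fin N) ℝ)
      (c y g μ : Fin N → ℕ → ℝ), IsNetwork E W a B → IsPushSumWeight W c →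
      (∀ t, 1 ≤ t → ∀ i, |g i t| ≤ F) → (∀ i, y i 1 = g i 1) →
      (∀ t, 1 ≤ t → ∀ i, y i (t + 1) = ∑ j, W t i j * y j t + g i (t + 1) - g i t) →
      (∀ i, μ i 1 = 0) →
      (∀ t, 1 ≤ t → ∀ i, μ i (t + 1) = max (∑ j, W t i j * μ j t + y i (t + 1)) 0) →
      ∀ t, 1 ≤ t → (∀ i, 0 ≤ μ i t) ∧
        (∀ i, |(∑ j, W t i j * μ j t) / c i (t + 1) - (∑ j, μ j t) / N| ≤ Q) ∧
        (∑ i, μ i (t + 1)) ^ 2 ≤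
          (∑ i, μ i t) ^ 2 + 2 * (∑ i, μ i t) * ∑ i, g i (t + 1) + K ∧
        ∑ i, μ i t + ∑ i, g i (t + 1) ≤ ∑ i, μ i (t + 1) := by
  obtain ⟨Y, hY0, hY⟩ := tracking_bounded N B a F ha ha1 hB hF
  obtain ⟨Q, hQ0, hQ⟩ := pushSum_spread_bounded N B a 0 Y ha ha1 hB le_rfl hY0
  set κ := a ^ (N * B + B) with hκ
  have hκ0 : 0 < κ := pow_pos ha _
  set M := N * (Y / κ + Q) with hM
  have hM0 : 0 ≤ M := by positivity
  refine ⟨Q, 2 * N * (M * Y) + (N * Y) ^ 2, hQ0, by positivity, ?_⟩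
  intro E W c y g μ hnet hc hg hy1 hy hμ1 hμ t ht
  have hμ0 : ∀ t, 1 ≤ t → ∀ i, 0 ≤ μ i t := by
    intro t ht i
    rcases ht.eq_or_lt with rfl | h
    · rw [hμ1]
    · obtain ⟨t, rfl⟩ := Nat.exists_eq_add_of_le' ht
      rw [hμ t (by omega)]
      exact le_max_right _ _
  have hY' := hY E W c y g hnet hc hg hy1 hy
  have hv0 : ∀ t, 1 ≤ t → ∀ i, 0 ≤ ∑ j, W t i j * μ j t := fun t ht i =>
    Finset.sum_nonneg fun j _ => mul_nonneg (hnet.nonneg ht i j) (hμ0 t ht j)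
  have hosc := hQ E W c μ hnet hc (fun i j => by rw [hμ1, hμ1, sub_zero])
    (fun t ht i => by
      have h1 := abs_le.1 ((hY' (t + 1) (by omega)).2 i)
      have h2 := hv0 t ht i
      rw [hμ t ht i, abs_le]
      rcases le_total 0 (∑ j, W t i j * μ j t + y i (t + 1)) with h | h
      · rw [max_eq_left h]
        constructor <;> linarith
      · rw [max_eq_right h]
        constructor <;> linarith) t ht
  have hcκ : ∀ {t}, 1 ≤ t → ∀ i, κ ≤ c i t := fun ht i => hc.pow_le ha ha1 hB hnet ht i
  have hcpos : ∀ {t}, 1 ≤ t → ∀ i, 0 < c i t := fun ht i => hκ0.trans_le (hcκ ht i)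
  have hcons : ∀ i, |(∑ j, W t i j * μ j t) / c i (t + 1) - (∑ j, μ j t) / N| ≤ Q := by
    intro i
    have hN : 0 < (N : ℝ) := by exact_mod_cast i.pos
    have h1 : ∀ l, |(∑ j, W t i j * μ j t) / c i (t + 1) - μ l t / c l t| ≤ Q := by
      intro l
      have h2 := abs_weighted_average_sub_le Finset.univ (w := fun j => W t i j * c j t)
        (b := fun j => μ j t / c j t) (r := μ l t / c l t) (Q := Q)
        (fun j _ => mul_nonneg (hnet.nonneg ht i j) (hcpos ht j).le) (hc.2 t ht i).symm
        (hcpos (by omega) i) (fun j _ => abs_le.2 ⟨by linarith [hosc l j], hosc j l⟩)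
      simpa only [mul_assoc, fun j => mul_div_cancel₀ (μ j t) (hcpos ht j).ne'] using h2
    have h3 := abs_weighted_average_sub_le Finset.univ (w := fun j => c j t)
      (b := fun j => μ j t / c j t) (r := (∑ j, W t i j * μ j t) / c i (t + 1)) (Q := Q)
      (fun j _ => (hcpos ht j).le) (hc.sum_eq hnet ht) hN
      (fun l _ => by rw [abs_sub_comm]; exact h1 l)
    simp only [fun j => mul_div_cancel₀ (μ j t) (hcpos ht j).ne'] at h3
    rwa [abs_sub_comm]
  refine ⟨hμ0 t ht, hcons, ?_, ?_⟩
  · have h := sq_sum_clip_le (v := fun i => ∑ j, W t i j * μ j t) (y := fun i => y i (t + 1))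
      hY0 hM0 (hv0 t ht) (hY' (t + 1) (by omega)).2 (fun i hi => by
        have hN : 0 < (N : ℝ) := by exact_mod_cast i.pos
        have h1 := (abs_le.1 (hcons i)).1
        have h2 : (∑ j, W t i j * μ j t) / c i (t + 1) ≤ Y / κ :=
          div_le_div₀ hY0 hi hκ0 (hcκ (by omega) i)
        rw [hnet.sum_sum_mul ht, hM, ← div_le_iff₀' hN]
        linarith)
    simpa only [hμ t ht, hnet.sum_sum_mul ht, (hY' (t + 1) (by omega)).1] using h
  · rw [← (hY' (t + 1) (by omega)).1, ← hnet.sum_sum_mul ht, ← Finset.sum_add_distrib]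
    exact Finset.sum_le_sum fun i _ => by rw [hμ t ht i]; exact le_max_left _ _

/-! ### The proximal minimization step -/

/-- The three-point inequality for a proximal step: the minimizer of a convex function plus
`η * ‖· - x‖ ^ 2` over a convex set gains `η * ‖z - x⁺‖ ^ 2` over every other point `z`. -/
theorem prox_three_point {H : Type*} [NormedAddCommGroup H] [InnerProductSpace ℝ H] {X : Set H}
    {φ : H → ℝ} (hφ : ConvexOn ℝ X φ) {η : ℝ} {x x' z : H} (hx' : x' ∈ X) (hz : z ∈ X)
    (hmin : IsMinOn (fun w => φ w + η * ‖w - x‖ ^ 2) X x') :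
    φ x' + η * ‖x' - x‖ ^ 2 + η * ‖z - x'‖ ^ 2 ≤ φ z + η * ‖z - x‖ ^ 2 := by
  -- compare `x'` with the points of the segment from `x'` to `z` near `x'`
  have key : ∀ θ : ℝ, 0 < θ → θ < 1 →
      φ x' + η * ‖x' - x‖ ^ 2 + (1 - θ) * (η * ‖z - x'‖ ^ 2) ≤ φ z + η * ‖z - x‖ ^ 2 := by
    intro θ h0 h1
    have hw : (1 - θ) • x' + θ • z ∈ X := hφ.1 hx' hz (by linarith) h0.le (by ring)
    have h2 := hφ.2 hx' hz (by linarith : (0 : ℝ) ≤ 1 - θ) h0.le (by ring)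
    have h3 : φ x' + η * ‖x' - x‖ ^ 2 ≤
        φ ((1 - θ) • x' + θ • z) + η * ‖(1 - θ) • x' + θ • z - x‖ ^ 2 := hmin hw
    have h4 : ‖(1 - θ) • x' + θ • z - x‖ ^ 2 =
        (1 - θ) * ‖x' - x‖ ^ 2 + θ * ‖z - x‖ ^ 2 - θ * (1 - θ) * ‖z - x'‖ ^ 2 := by
      rw [show (1 - θ) • x' + θ • z - x = (1 - θ) • (x' - x) + θ • (z - x) by module,
        show z - x' = (z - x) - (x' - x) by abel, norm_add_sq_real,
        norm_sub_sq_real (z - x) (x' - x),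
        norm_smul, norm_smul, inner_smul_left, inner_smul_right, real_inner_comm (z - x)]
      simp only [Real.norm_eq_abs, mul_pow, sq_abs, RCLike.conj_to_real]
      ring
    rw [h4] at h3
    simp only [smul_eq_mul] at h2
    nlinarith
  have hlim : Filter.Tendsto (fun θ : ℝ => φ x' + η * ‖x' - x‖ ^ 2 + (1 - θ) * (η * ‖z - x'‖ ^ 2))
      (nhdsWithin 0 (Set.Ioi 0)) (nhds (φ x' + η * ‖x' - x‖ ^ 2 + (1 - 0) * (η * ‖z - x'‖ ^ 2))) :=
    Continuous.continuousWithinAt (by fun_prop)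
  rw [sub_zero, one_mul] at hlim
  refine le_of_tendsto hlim ?_
  filter_upwards [Ioo_mem_nhdsGT (zero_lt_one' ℝ)] with θ hθ using key θ hθ.1 hθ.2

theorem inner_eq_sum_mul {p : ℕ} (u v : Vec p) : inner ℝ u v = ∑ k, u k * v k := by
  rw [PiLp.inner_apply]
  exact Finset.sum_congr rfl fun k _ => by simp [mul_comm]

/-- The effect of one minimization step of DUST at one node, compared with a fixed decision `z`. -/
theorem inner_multiplier_le {n p : ℕ} {X : Set (Vec n)} {g : Vec n → Vec p} {l : Vec p}
    {v x x' z : Vec n} {α η G R : ℝ} (hX : IsCompact X) (hconv : Convex ℝ X)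
    (hR : Metric.diam X ≤ R) (hg : ∀ k, ConvexOn ℝ X (fun w => g w k)) (hl : ∀ k, 0 ≤ l k)
    (hv : ‖v‖ ≤ G) (hα : 0 ≤ α) (hη : 0 ≤ η) (hx : x ∈ X) (hx' : x' ∈ X) (hz : z ∈ X)
    (hmin : IsMinOn (fun w => α * inner ℝ v (w - x) + inner ℝ l (g w) + η * ‖w - x‖ ^ 2) X x') :
    inner ℝ l (g x') ≤
      inner ℝ l (g z) + 2 * (α * (G * R)) + η * (‖z - x‖ ^ 2 - ‖z - x'‖ ^ 2) := by
  have hφ : ConvexOn ℝ X (fun w => α * inner ℝ v (w - x) + inner ℝ l (g w)) := by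
    refine ConvexOn.add ⟨hconv, fun w _ w' _ b b' _ _ hbb => le_of_eq ?_⟩ ?_
    · obtain rfl : b' = 1 - b := by linarith
      simp only [smul_eq_mul, inner_sub_right, inner_add_right, inner_smul_right]
      ring
    · simp only [inner_eq_sum_mul]
      exact ⟨hconv, fun w hw w' hw' b b' hb hb' hbb => by
        simp only [smul_eq_mul, Finset.mul_sum, ← Finset.sum_add_distrib]
        refine Finset.sum_le_sum fun k _ => ?_
        have h := mul_le_mul_of_nonneg_left ((hg k).2 hw hw' hb hb' hbb) (hl k)
        simp only [smul_eq_mul] at h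
        linarith⟩
  have h1 := prox_three_point hφ hx' hz hmin
  have hin : ∀ w ∈ X, |inner ℝ v (w - x)| ≤ G * R := fun w hw => by
    refine (abs_real_inner_le_norm _ _).trans (mul_le_mul hv ?_ (norm_nonneg _)
      ((norm_nonneg _).trans hv))
    rw [← dist_eq_norm]
    exact (Metric.dist_le_diam_of_mem hX.isBounded hw hx).trans hR
  have h2 := mul_le_mul_of_nonneg_left (abs_le.1 (hin x' hx')).1 hα
  have h3 := mul_le_mul_of_nonneg_left (abs_le.1 (hin z hz)).2 hα
  have h4 : 0 ≤ η * ‖x' - x‖ ^ 2 := by positivity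
  linarith

/-! ### Growth of the multipliers -/

/-- A potential `V` that exceeds `S ^ 2` by at most `A * t`, and whose increments are at most
`K * √t - 2 * ε * S`, is `O(t)`: once `V t` exceeds a multiple of `t`, the
increment is nonpositive. -/
theorem potential_le {V S : ℕ → ℝ} {ε K A : ℝ} (hε : 0 < ε) (hK : 0 ≤ K) (hA : 0 ≤ A)
    (hS : ∀ t, 1 ≤ t → 0 ≤ S t) (hV1 : V 1 ≤ A)
    (hVS : ∀ t : ℕ, 1 ≤ t → V t ≤ S t ^ 2 + A * t)
    (hV : ∀ t : ℕ, 1 ≤ t → V (t + 1) ≤ V t - 2 * ε * S t + K * Real.sqrt t) :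
    ∀ t : ℕ, 1 ≤ t → V t ≤ (A + (K / (2 * ε)) ^ 2 + K) * t := by
  intro t ht
  induction t, ht using Nat.le_induction with
  | base =>
    have := sq_nonneg (K / (2 * ε))
    push_cast
    linarith
  | succ t ht ih =>
    have ht' : (1 : ℝ) ≤ t := by exact_mod_cast ht
    have hC : 0 ≤ A + (K / (2 * ε)) ^ 2 + K := by positivity
    have hst : Real.sqrt t ≤ t := Real.sqrt_le_self_iff.2 (Or.inr ht')
    have hq : 0 ≤ K / (2 * ε) := by positivity
    push_cast
    rcases le_or_gt (V t) ((A + (K / (2 * ε)) ^ 2) * t) with h | h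
    · have h1 := mul_nonneg hε.le (hS t ht)
      have h2 := mul_le_mul_of_nonneg_left hst hK
      linarith [hV t ht]
    · have h1 : (K / (2 * ε) * Real.sqrt t) ^ 2 ≤ S t ^ 2 := by
        rw [mul_pow, Real.sq_sqrt (by linarith)]
        linarith [hVS t ht]
      have h2 := (pow_le_pow_iff_left₀ (by positivity) (hS t ht) two_ne_zero).1 h1
      have h3 : K * Real.sqrt t ≤ 2 * ε * S t := by
        calc K * Real.sqrt t = 2 * ε * (K / (2 * ε) * Real.sqrt t) := by field_simp
          _ ≤ _ := mul_le_mul_of_nonneg_left h2 (by positivity)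
      linarith [hV t ht]

/-! ### The drift inequality and the constraint violation -/

/-- One step of the drift analysis: the total multiplier `m = ∑ i, μ i t` loses `2 * ε * ‖m‖₁` in its
squared norm, up to the telescoping distances `Dt`, `Dt'` of the decisions to the Slater point. Here
`h` and `hhat` are the constraint values at the new decisions and at the Slater point. -/
theorem drift_step {N p : ℕ} {Q F ε K r b Dt Dt' : ℝ} (hN : 0 < N)
    {l h hhat : Fin N → Fin p → ℝ} {m m' : Fin p → ℝ}
    (hm : ∀ k, 0 ≤ m k) (hl : ∀ i k, |l i k - m k / N| ≤ Q) (hh : ∀ i k, |h i k| ≤ F)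
    (hhh : ∀ i k, |hhat i k| ≤ F) (hslater : ∀ k, ∑ i, hhat i k ≤ -ε)
    (hdual : ∀ k, m' k ^ 2 ≤ m k ^ 2 + 2 * m k * ∑ i, h i k + K)
    (hprimal : ∑ i, ∑ k, l i k * h i k ≤ ∑ i, ∑ k, l i k * hhat i k + b + r * (Dt - Dt')) :
    ∑ k, m' k ^ 2 + 2 * N * (r * Dt') ≤ ∑ k, m k ^ 2 + 2 * N * (r * Dt) - 2 * ε * ∑ k, m k +
      (2 * N * b + 4 * (N * (N * (p * (Q * F)))) + p * K) := by
  have hN' : (0 : ℝ) < N := by exact_mod_cast hN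
  -- replacing the local multipliers by the mean multiplier costs a constant
  have key : ∀ w : Fin N → Fin p → ℝ, (∀ i k, |w i k| ≤ F) →
      |N * ∑ i, ∑ k, l i k * w i k - ∑ k, m k * ∑ i, w i k| ≤ N * (N * (p * (Q * F))) := by
    intro w hw
    have h1 : N * ∑ i, ∑ k, l i k * w i k - ∑ k, m k * ∑ i, w i k =
        N * ∑ i, ∑ k, (l i k - m k / N) * w i k := by
      have h2 : ∑ k, m k * ∑ i, w i k = N * ∑ i, ∑ k, m k / N * w i k := by
        rw [Finset.sum_comm, Finset.mul_sum]
        refine Finset.sum_congr rfl fun k _ => ?_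
        rw [← Finset.mul_sum]
        field_simp
      simp only [h2, sub_mul, Finset.sum_sub_distrib]
      ring
    rw [h1, abs_mul, abs_of_pos hN']
    refine mul_le_mul_of_nonneg_left ?_ hN'.le
    calc |∑ i, ∑ k, (l i k - m k / N) * w i k|
        ≤ ∑ i, |∑ k, (l i k - m k / N) * w i k| := Finset.abs_sum_le_sum_abs _ _
      _ ≤ ∑ _i : Fin N, (p : ℝ) * (Q * F) := Finset.sum_le_sum fun i _ => by
          calc |∑ k, (l i k - m k / N) * w i k|
              ≤ ∑ k, |(l i k - m k / N) * w i k| := Finset.abs_sum_le_sum_abs _ _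
            _ ≤ ∑ _k : Fin p, Q * F := Finset.sum_le_sum fun k _ => by
                rw [abs_mul]
                exact mul_le_mul (hl i k) (hw i k) (abs_nonneg _)
                  ((abs_nonneg _).trans (hl i k))
            _ = p * (Q * F) := by simp
      _ = N * (p * (Q * F)) := by simp
  have h1 := (abs_le.1 (key h hh)).1
  have h2 := (abs_le.1 (key hhat hhh)).2
  have h3 : ∑ k, m k * ∑ i, hhat i k ≤ -ε * ∑ k, m k := by
    rw [Finset.mul_sum]
    refine Finset.sum_le_sum fun k _ => ?_
    rw [mul_comm (-ε)]
    exact mul_le_mul_of_nonneg_left (hslater k) (hm k)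
  have h4 : ∑ k, m' k ^ 2 ≤ ∑ k, m k ^ 2 + 2 * ∑ k, m k * ∑ i, h i k + p * K := by
    calc ∑ k, m' k ^ 2 ≤ ∑ k, (m k ^ 2 + 2 * m k * ∑ i, h i k + K) :=
          Finset.sum_le_sum fun k _ => hdual k
      _ = _ := by
          simp only [Finset.sum_add_distrib, Finset.mul_sum, mul_assoc]
          simp
  have h5 := mul_le_mul_of_nonneg_left hprimal hN'.le
  linarith

theorem norm_posProj_le {p : ℕ} {v : Vec p} {b : ℝ} (hb : 0 ≤ b) (hv : ∀ k, v k ≤ b) :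
    ‖posProj v‖ ≤ p * b := by
  rw [EuclideanSpace.norm_eq]
  refine Real.sqrt_le_iff.2 ⟨by positivity, ?_⟩
  have h1 : ∀ k, ‖posProj v k‖ ^ 2 ≤ b ^ 2 := by
    intro k
    have h2 : posProj v k = max (v k) 0 := rfl
    rw [h2, Real.norm_eq_abs, sq_abs]
    exact pow_le_pow_left₀ (le_max_right _ _) (max_le (hv k) hb) 2
  calc ∑ k, ‖posProj v k‖ ^ 2 ≤ ∑ _k : Fin p, b ^ 2 := Finset.sum_le_sum fun k _ => h1 k
    _ = p * b ^ 2 := by simp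
    _ ≤ (p * b) ^ 2 := by
      rw [mul_pow]
      refine mul_le_mul_of_nonneg_right ?_ (sq_nonneg b)
      exact_mod_cast Nat.le_self_pow two_ne_zero p

theorem theorem3 (N p : ℕ) (a : ℝ) (ha0 : 0 < a) (ha1 : a < 1) (B : ℕ) (hB : 0 < B)
    (R F G ε : ℝ) (hF : 0 < F) (hG : 0 < G) (hε : 0 < ε) :
    ∃ C : ℝ, ∀ (P : OnlineProblem N p) (E : ℕ → Digraph (Fin N))
      (W : ℕ → Matrix (Fin N) (Fin N) ℝ) (s : ∀ i, ℕ → Vec (P.d i) → Vec (P.d i))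
      (x : ∀ i, ℕ → Vec (P.d i)) (c : Fin N → ℕ → ℝ) (lam y μ : Fin N → ℕ → Vec p),
      IsNetwork E W a B →
      P.IsConvex R →
      (∀ i, ∀ z ∈ P.X i, ‖P.g i z‖ ≤ F) →
      P.IsSubgradientChoice s →
      (∀ i, ∀ t, 1 ≤ t → ∀ z ∈ P.X i, ‖s i t z‖ ≤ G) →
      P.Slater ε →
      IsDUST P E W s (fun t => Real.sqrt t) (fun t => (t : ℝ)) x c lam y μ →
      ∀ T : ℕ, 1 ≤ T → P.constraintViolation x T ≤ C * Real.sqrt T := by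
  obtain ⟨Q, K, hQ0, hK0, hQK⟩ := dual_recursion N B a F ha0 ha1 hB hF.le
  -- without nodes the violation is the norm of an empty sum
  rcases Nat.eq_zero_or_pos N with rfl | hN
  · refine ⟨0, fun P E W s x c lam y μ _ _ _ _ _ _ _ T _ => ?_⟩
    have h := norm_posProj_le (v := ∑ t ∈ Finset.Icc 1 T, ∑ i, P.g i (x i t)) le_rfl
      (fun k => by simp)
    simpa [OnlineProblem.constraintViolation] using h
  have hN' : (0 : ℝ) < N := by exact_mod_cast hN
  set R' := max R 0 with hR'
  have hR0 : 0 ≤ R' := le_max_right _ _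
  set A : ℝ := 2 * N * (N * R' ^ 2) with hA
  have hA0 : 0 ≤ A := by positivity
  set L : ℝ := 2 * N * (N * (2 * (G * R'))) + (4 * (N * (N * (p * (Q * F)))) + p * K) + A with hL
  have hL0 : 0 ≤ L := by positivity
  set C := A + (L / (2 * ε)) ^ 2 + L with hC
  refine ⟨p * (N * F + Real.sqrt C), ?_⟩
  intro P E W s x c lam y μ hnet hP hgF _ hsG ⟨xhat, hxhat, hslater⟩ hrun T hT
  have hw : IsPushSumWeight W c := ⟨hrun.c_one, fun t ht i => by
    rw [hrun.c_succ t ht i]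
    exact hnet.sum_inNeighbors ht i fun j => c j t⟩
  have hxX : ∀ t, 1 ≤ t → ∀ i, x i t ∈ P.X i := by
    intro t ht i
    rcases ht.eq_or_lt with rfl | h
    · exact hrun.x_one i
    · obtain ⟨t, rfl⟩ := Nat.exists_eq_add_of_le' ht
      exact hrun.x_succ_mem t (by omega) i
  have hxhX : ∀ i, xhat i ∈ P.X i := fun i => intrinsicInterior_subset (hxhat i)
  have hgk : ∀ i, ∀ z ∈ P.X i, ∀ k, |P.g i z k| ≤ F := fun i z hz k =>
    (PiLp.norm_apply_le (P.g i z) k).trans (hgF i z hz)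
  have hcoord : ∀ k, _ := fun k => hQK E W c (fun i t => y i t k) (fun i t => P.g i (x i t) k)
    (fun i t => μ i t k) hnet hw (fun t ht i => hgk i _ (hxX t ht i) k)
    (fun i => by rw [hrun.y_one])
    (fun t ht i => by
      rw [hrun.y_succ t ht i, hnet.sum_inNeighbors ht]
      simp)
    (fun i => by rw [hrun.μ_one]; rfl)
    (fun t ht i => by
      rw [hrun.μ_succ t ht i, hnet.sum_inNeighbors ht]
      simp [posProj])
  have hlam : ∀ t, 1 ≤ t → ∀ i k, lam i (t + 1) k = (∑ j, W t i j * μ j t k) / c i (t + 1) := by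
    intro t ht i k
    rw [hrun.lam_succ t ht i, hnet.sum_inNeighbors ht]
    simp [div_eq_inv_mul]
  have hm0 : ∀ t, 1 ≤ t → ∀ k, 0 ≤ ∑ i, μ i t k := fun t ht k =>
    Finset.sum_nonneg fun i _ => (hcoord k t ht).1 i
  have hlam0 : ∀ t, 1 ≤ t → ∀ i k, 0 ≤ lam i (t + 1) k := fun t ht i k => by
    rw [hlam t ht]
    exact div_nonneg (Finset.sum_nonneg fun j _ => mul_nonneg (hnet.nonneg ht i j)
      ((hcoord k t ht).1 j)) (hw.nonneg hnet (by omega) i)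
  have hprimal : ∀ t, 1 ≤ t → ∑ i, ∑ k, lam i (t + 1) k * P.g i (x i (t + 1)) k ≤
      ∑ i, ∑ k, lam i (t + 1) k * P.g i (xhat i) k + N * (2 * (Real.sqrt t * (G * R'))) +
        t * (∑ i, ‖xhat i - x i t‖ ^ 2 - ∑ i, ‖xhat i - x i (t + 1)‖ ^ 2) := by
    intro t ht
    have h1 : ∑ i, ∑ k, lam i (t + 1) k * P.g i (x i (t + 1)) k ≤
        ∑ i, (∑ k, lam i (t + 1) k * P.g i (xhat i) k + 2 * (Real.sqrt t * (G * R')) +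
          t * (‖xhat i - x i t‖ ^ 2 - ‖xhat i - x i (t + 1)‖ ^ 2)) := by
      refine Finset.sum_le_sum fun i _ => ?_
      rw [← inner_eq_sum_mul, ← inner_eq_sum_mul]
      exact inner_multiplier_le (hP.isCompact i) (hP.convex i)
        ((hP.diam_le i).trans (le_max_left _ _)) (hP.convex_g i) (hlam0 t ht i)
        (hsG i t ht _ (hxX t ht i)) (Real.sqrt_nonneg _) (Nat.cast_nonneg t) (hxX t ht i)
        (hrun.x_succ_mem t ht i) (hxhX i) (hrun.x_succ_isMin t ht i)
    refine h1.trans (le_of_eq ?_)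
    simp only [Finset.sum_add_distrib, ← Finset.mul_sum, Finset.sum_sub_distrib, Finset.sum_const,
      Finset.card_univ, Fintype.card_fin, nsmul_eq_mul]
    ring
  have hD : ∀ t, 1 ≤ t → ∑ i, ‖xhat i - x i t‖ ^ 2 ≤ N * R' ^ 2 := by
    intro t ht
    calc ∑ i, ‖xhat i - x i t‖ ^ 2 ≤ ∑ _i : Fin N, R' ^ 2 := Finset.sum_le_sum fun i _ => by
          refine pow_le_pow_left₀ (norm_nonneg _) ?_ 2
          rw [← dist_eq_norm]
          exact (Metric.dist_le_diam_of_mem (hP.isCompact i).isBounded (hxhX i)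
            (hxX t ht i)).trans ((hP.diam_le i).trans (le_max_left _ _))
      _ = N * R' ^ 2 := by simp
  have hD0 : ∀ t, 0 ≤ ∑ i, ‖xhat i - x i t‖ ^ 2 := fun t =>
    Finset.sum_nonneg fun i _ => sq_nonneg _
  -- the potential is `‖m t‖ ^ 2 + 2 * N * t * D t`, with `m t = ∑ i, μ i t` and `D t` the sum of the
  -- squared distances of the decisions to the Slater point; the weight `t` of `D t` is the proximal
  -- parameter, so that the distances telescope up to the bounded term `2 * N * D (t + 1)`
  have hV := potential_le
    (V := fun t => ∑ k, (∑ i, μ i t k) ^ 2 + 2 * N * (t * ∑ i, ‖xhat i - x i t‖ ^ 2))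
    (S := fun t => ∑ k, ∑ i, μ i t k) hε hL0 hA0
    (fun t ht => Finset.sum_nonneg fun k _ => hm0 t ht k)
    (by
      have h1 := mul_le_mul_of_nonneg_left (hD 1 le_rfl) (by positivity : (0 : ℝ) ≤ 2 * N)
      simp only [hrun.μ_one]
      simpa [hA] using h1)
    (fun t ht => by
      have h1 : ∑ k, (∑ i, μ i t k) ^ 2 ≤ (∑ k, ∑ i, μ i t k) ^ 2 :=
        Finset.sum_sq_le_sq_sum_of_nonneg fun k _ => hm0 t ht k
      have h2 := mul_le_mul_of_nonneg_left (hD t ht) (by positivity : (0 : ℝ) ≤ 2 * N * t)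
      rw [hA]
      linarith)
    (fun t ht => by
      have h1 := drift_step (l := fun i k => lam i (t + 1) k)
        (h := fun i k => P.g i (x i (t + 1)) k) (hhat := fun i k => P.g i (xhat i) k)
        (m := fun k => ∑ i, μ i t k) (m' := fun k => ∑ i, μ i (t + 1) k) (Q := Q) (F := F)
        (ε := ε) hN (hm0 t ht)
        (fun i k => by rw [hlam t ht]; exact (hcoord k t ht).2.1 i)
        (fun i k => hgk i _ (hxX (t + 1) (by omega) i) k)
        (fun i k => hgk i _ (hxhX i) k)
        (fun k => by simpa using hslater k)
        (fun k => (hcoord k t ht).2.2.1) (hprimal t ht)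
      have h2 := mul_le_mul_of_nonneg_left (hD (t + 1) (by omega))
        (by positivity : (0 : ℝ) ≤ 2 * N)
      have h3 : 1 ≤ Real.sqrt t := Real.one_le_sqrt.2 (by exact_mod_cast ht)
      have h4 : 0 ≤ 4 * (N * (N * (p * (Q * F)))) + p * K + A := by positivity
      have h5 := mul_le_mul_of_nonneg_left h3 h4
      rw [← hA] at h2
      rw [hL]
      push_cast
      linarith)
  have hmT : ∀ k, ∑ i, μ i T k ≤ Real.sqrt C * Real.sqrt T := by
    intro k
    rw [← Real.sqrt_mul (by positivity)]
    refine Real.le_sqrt_of_sq_le ?_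
    have h1 : (∑ i, μ i T k) ^ 2 ≤ ∑ k, (∑ i, μ i T k) ^ 2 :=
      Finset.single_le_sum (f := fun k => (∑ i, μ i T k) ^ 2) (fun k _ => sq_nonneg _)
        (Finset.mem_univ k)
    have h2 : 0 ≤ 2 * N * (T * ∑ i, ‖xhat i - x i T‖ ^ 2) :=
      mul_nonneg (by positivity) (mul_nonneg (by positivity) (hD0 T))
    have h3 := hV T hT
    simp only at h3
    linarith
  -- the multipliers accumulate the constraint values of the times `2, …, T`
  have hacc : ∀ t, 1 ≤ t → ∀ k, ∑ r ∈ Finset.Icc 1 t, ∑ i, P.g i (x i r) k ≤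
      N * F + ∑ i, μ i t k := by
    intro t ht k
    induction t, ht using Nat.le_induction with
    | base =>
      have h1 : ∑ i, P.g i (x i 1) k ≤ ∑ _i : Fin N, F :=
        Finset.sum_le_sum fun i _ => (abs_le.1 (hgk i _ (hrun.x_one i) k)).2
      have h2 := hm0 1 le_rfl k
      simp only [Finset.sum_const, Finset.card_univ, Fintype.card_fin, nsmul_eq_mul] at h1
      rw [Finset.Icc_self, Finset.sum_singleton]
      linarith
    | succ t ht ih =>
      rw [Finset.sum_Icc_succ_top (by omega)]
      linarith [(hcoord k t ht).2.2.2]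
  have h1T : 1 ≤ Real.sqrt T := Real.one_le_sqrt.2 (by exact_mod_cast hT)
  rw [mul_assoc]
  refine norm_posProj_le (by positivity) fun k => ?_
  have h1 := hacc T hT k
  have h2 := mul_le_mul_of_nonneg_left h1T (by positivity : (0 : ℝ) ≤ N * F)
  simp only [WithLp.ofLp_sum, Finset.sum_apply]
  linarith [hmT k]
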